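/- For $k\in\mathbb N=\{0,1,2,\dots\}$ let $J_k$ be the Bessel function and $I_k$ the modified Bessel function of the first kind of order $k$, and for $\kappa>0$ let $$F_k(\alpha)=F_k(\alpha,\kappa):=\frac{\kappa}{\alpha}\,J_k(\alpha)\,I_k'\Bigl(\frac{\kappa}{\alpha}\Bigr)-\alpha\,I_k\Bigl(\frac{\kappa}{\alpha}\Bigr)J_k'(\alpha),\qquad \alpha>0.$$ For every $k\in\mathbb N$ and $\kappa>0$, the positive roots of $F_k(\cdot,\kappa)$ can be ordered as an infinite strictly increasing sequence $\alpha_{k,1}(\kappa)<\alpha_{k,2}(\kappa)<\cdots$ (containing all of them). Moreover, for every $k\in\mathbb N$ and every integer $\ell\ge1$, the function $\kappa\mapsto\alpha_{k,\ell}(\kappa)$ is of class $C^1$ on $(0,\infty)$ and $\partial_\kappa\alpha_{k,\ell}(\kappa)<0$ for all $\kappa>0$. -/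

import Mathlib

/-- The Bessel function of the first kind `J_k` of order `k ∈ ℕ` on the real line, defined by its
(everywhere absolutely convergent) power series
`J_k(x) = ∑_{m ≥ 0} (-1)^m / (m! (m+k)!) (x/2)^(2m+k)`. -/
noncomputable def besselJ (k : ℕ) (x : ℝ) : ℝ :=
  ∑' m : ℕ, (-1 : ℝ) ^ m / ((m.factorial : ℝ) * ((m + k).factorial : ℝ)) * (x / 2) ^ (2 * m + k)

/-- The modified Bessel function of the first kind `I_k` of order `k ∈ ℕ` on the real line, defined
by its (everywhere absolutely convergent) power series
`I_k(x) = ∑_{m ≥ 0} 1 / (m! (m+k)!) (x/2)^(2m+k)`. -/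
noncomputable def besselI (k : ℕ) (x : ℝ) : ℝ :=
  ∑' m : ℕ, 1 / ((m.factorial : ℝ) * ((m + k).factorial : ℝ)) * (x / 2) ^ (2 * m + k)

/-- The function `F_k(α) = (κ/α) J_k(α) I_k'(κ/α) - α I_k(κ/α) J_k'(α)`, considered for `κ > 0` and
`α > 0`. -/
noncomputable def bucklingF (k : ℕ) (κ α : ℝ) : ℝ :=
  κ / α * besselJ k α * deriv (besselI k) (κ / α) - α * besselI k (κ / α) * deriv (besselJ k) α

/-- `alphaRoot k ℓ κ`, for `ℓ ≥ 1`, is the `ℓ`-th positive root `α_{k,ℓ}(κ)` of `F_k` in increasing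
order: the first one is the smallest root in `(0, ∞)`, and the next one is always the smallest root
beyond the previous one. The value `0` at `ℓ = 0` is only the starting point of the recursion. -/
noncomputable def alphaRoot (k : ℕ) : ℕ → ℝ → ℝ
  | 0, _ => 0
  | ℓ + 1, κ => sInf {x : ℝ | alphaRoot k ℓ κ < x ∧ bucklingF k κ x = 0}

/-! Put `y = κ/α`, `P = y I_k'(y)`, `Q = α J_k'(α)`, so that `F = J P - I Q` with `J = J_k(α)`, `I =
I_k(y)`. Up to and including the first positive zero of `J_k`, `F > 0`, because `P > k I` and `Q < k
J`. At a zero of `J_k`, `F = -I Q` is nonzero and its sign alternates from one zero to the next, so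
`F` has a root in each gap between consecutive zeros.

At a root in a gap, Bessel's equations together with `J P = I Q` give `α I J ∂_α F = J² (2 P² - (y²
+ 2 k² - α²) I²)` and `α y I J ∂_κ F = J² ((k² + y²) I² - P²)`. The second is positive by a monotone
energy (`besselI_energy_pos`), the first by the sharp bound `P ≥ (√(y² + (k+1)²) - 1) I`
(`sqrt_sub_one_mul_besselI_le`) and `α > 1`. Hence all roots in a gap are crossed in the same
direction, so there is exactly one, and the implicit function theorem gives `α' = -∂_κ F / ∂_α F <
0`. -/

open Set Filter Topology

/-! ### Power series, smoothness and Bessel's equations -/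

/-- The entire function `∑ z ^ m / (m! (m + k)!)`, through which the Bessel functions `J_k` and
`I_k` are expressed. -/
noncomputable def besselClifford (k : ℕ) (z : ℝ) : ℝ :=
  ∑' m : ℕ, z ^ m / ((m.factorial : ℝ) * ((m + k).factorial : ℝ))

lemma abs_besselClifford_term_le (k m : ℕ) (z : ℝ) :
    ‖z ^ m / ((m.factorial : ℝ) * ((m + k).factorial : ℝ))‖ ≤ |z| ^ m / (m.factorial : ℝ) := by
  rw [norm_div, norm_pow, Real.norm_eq_abs, Real.norm_of_nonneg (r := _ * _) (by positivity)]
  have h : (1 : ℝ) ≤ (m + k).factorial := by exact_mod_cast Nat.factorial_pos _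
  exact div_le_div_of_nonneg_left (by positivity) (by positivity)
    (le_mul_of_one_le_right (by positivity) h)

lemma summable_besselClifford (k : ℕ) (z : ℝ) :
    Summable fun m : ℕ => z ^ m / ((m.factorial : ℝ) * ((m + k).factorial : ℝ)) :=
  .of_norm_bounded (Real.summable_pow_div_factorial |z|)
    fun m => abs_besselClifford_term_le k m z

lemma hasDerivAt_besselClifford (k : ℕ) (z : ℝ) :
    HasDerivAt (besselClifford k) (besselClifford (k + 1) z) z := by
  set R : ℝ := |z| + 1
  have hR : 0 ≤ R := by positivity
  -- Majorant of the differentiated terms on `(-R, R)`, for termwise differentiation.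
  let u : ℕ → ℝ := fun m => m * R ^ (m - 1) / m.factorial
  have hu : Summable u := by
    rw [← summable_nat_add_iff 1]
    refine (Real.summable_pow_div_factorial R).congr fun m => ?_
    simp only [u, Nat.factorial_succ, Nat.add_sub_cancel]
    push_cast
    field_simp
  have key := hasDerivAt_tsum_of_isPreconnected (𝕜 := ℝ) (F := ℝ)
    (g := fun m z => z ^ m / ((m.factorial : ℝ) * ((m + k).factorial : ℝ)))
    (g' := fun m z => (m * z ^ (m - 1)) / ((m.factorial : ℝ) * ((m + k).factorial : ℝ)))
    (t := Ioo (-R) R) (y₀ := z) (y := z) hu isOpen_Ioo isPreconnected_Ioo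
    (fun m y _ => (hasDerivAt_pow m y).div_const _) (fun m y hy => ?_)
    (abs_lt.1 (by simp [R])) (summable_besselClifford k z) (abs_lt.1 (by simp [R]))
  · refine key.congr_deriv ?_
    rw [Summable.tsum_eq_zero_add]
    · simp only [besselClifford]
      simp only [Nat.cast_zero, zero_mul, zero_div, zero_add, Nat.add_sub_cancel]
      refine tsum_congr fun m => ?_
      rw [Nat.factorial_succ, show m + 1 + k = m + (k + 1) by ring]
      push_cast
      field_simp
    · refine .of_norm_bounded (g := u) hu fun m => ?_
      have := abs_besselClifford_term_le k m 1
      simp only [u, norm_div, norm_mul, norm_pow, Real.norm_eq_abs, Nat.abs_cast]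
      have h1 : (1 : ℝ) ≤ (m + k).factorial := by
        exact_mod_cast Nat.factorial_pos _
      gcongr
      · simp [R]
      · nlinarith [show (0 : ℝ) < m.factorial by positivity]
  · have h1 : (1 : ℝ) ≤ (m + k).factorial := by
      exact_mod_cast Nat.factorial_pos _
    simp only [u, norm_div, norm_mul, norm_pow, Real.norm_eq_abs, Nat.abs_cast]
    gcongr
    · exact (abs_lt.2 hy).le
    · nlinarith [show (0 : ℝ) < m.factorial by positivity]

/-- Coefficientwise this is `m + (k + 1) = m + k + 1`. As differentiation raises the index, it is
the differential equation `z C'' + (k + 1) C' = C`, the source of both Bessel equations. -/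
lemma besselClifford_recurrence (k : ℕ) (z : ℝ) :
    z * besselClifford (k + 2) z + (k + 1) * besselClifford (k + 1) z = besselClifford k z := by
  have h0 := (summable_besselClifford k z).tsum_eq_zero_add
  have h1 := (summable_besselClifford (k + 1) z).tsum_eq_zero_add
  have s1 := (summable_nat_add_iff 1).2 (summable_besselClifford (k + 1) z)
  simp only [besselClifford]
  rw [h0, h1, mul_add, ← tsum_mul_left, ← tsum_mul_left, add_left_comm,
    ← Summable.tsum_add ((summable_besselClifford (k + 2) z).mul_left z) (s1.mul_left _)]
  congr 1
  · simp only [Nat.factorial_zero, zero_add, Nat.factorial_succ k]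
    push_cast
    field_simp
  · refine tsum_congr fun m => ?_
    rw [show m + 1 + k = m + k + 1 by ring, show m + 1 + (k + 1) = m + k + 1 + 1 by ring,
      show m + (k + 2) = m + k + 1 + 1 by ring, Nat.factorial_succ (m + k + 1),
      Nat.factorial_succ (m + k), Nat.factorial_succ m]
    push_cast
    field_simp
    ring

lemma contDiff_besselClifford (n k : ℕ) : ContDiff ℝ n (besselClifford k) := by
  induction n generalizing k with
  | zero =>
    exact contDiff_zero.2 (continuous_iff_continuousAt.2
      fun z => (hasDerivAt_besselClifford k z).continuousAt)
  | succ n ih =>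
    push_cast
    refine contDiff_succ_iff_deriv.2
      ⟨fun z => (hasDerivAt_besselClifford k z).differentiableAt, by simp, ?_⟩
    rw [show deriv (besselClifford k) = besselClifford (k + 1) from
      funext fun z => (hasDerivAt_besselClifford k z).deriv]
    exact ih _

lemma besselJ_eq (k : ℕ) (x : ℝ) :
    besselJ k x = (x / 2) ^ k * besselClifford k (-(x ^ 2 / 4)) := by
  rw [besselJ, besselClifford, ← tsum_mul_left]
  refine tsum_congr fun m => ?_
  rw [show -(x ^ 2 / 4) = (-1) * (x / 2) ^ 2 by ring, mul_pow, pow_add, pow_mul]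
  ring

lemma besselI_eq (k : ℕ) (x : ℝ) :
    besselI k x = (x / 2) ^ k * besselClifford k (x ^ 2 / 4) := by
  rw [besselI, besselClifford, ← tsum_mul_left]
  refine tsum_congr fun m => ?_
  rw [show (x ^ 2 / 4) = (x / 2) ^ 2 by ring, pow_add, pow_mul]
  ring

lemma contDiff_besselJ (n k : ℕ) : ContDiff ℝ n (besselJ k) := by
  rw [show besselJ k = _ from funext (besselJ_eq k)]
  exact ((contDiff_id.div_const 2).pow k).mul ((contDiff_besselClifford n k).comp (by fun_prop))

lemma contDiff_besselI (n k : ℕ) : ContDiff ℝ n (besselI k) := by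
  rw [show besselI k = _ from funext (besselI_eq k)]
  exact ((contDiff_id.div_const 2).pow k).mul ((contDiff_besselClifford n k).comp (by fun_prop))

lemma hasDerivAt_besselJ (k : ℕ) (x : ℝ) : HasDerivAt (besselJ k) (deriv (besselJ k) x) x :=
  ((contDiff_besselJ 1 k).differentiable (by simp) x).hasDerivAt

lemma hasDerivAt_besselI (k : ℕ) (x : ℝ) : HasDerivAt (besselI k) (deriv (besselI k) x) x :=
  ((contDiff_besselI 1 k).differentiable (by simp) x).hasDerivAt

lemma hasDerivAt_besselClifford_comp (k : ℕ) (c x : ℝ) :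
    HasDerivAt (fun x : ℝ => besselClifford k (c * x ^ 2))
      (besselClifford (k + 1) (c * x ^ 2) * (c * (2 * x))) x := by
  have h : HasDerivAt (fun x : ℝ => c * x ^ 2) (c * (2 * x)) x := by
    simpa using (hasDerivAt_pow 2 x).const_mul c
  exact (hasDerivAt_besselClifford k _).comp x h

lemma hasDerivAt_half_pow_mul (k : ℕ) {f : ℝ → ℝ} {f' x : ℝ} (hx : x ≠ 0)
    (hf : HasDerivAt f f' x) :
    HasDerivAt (fun x : ℝ => (x / 2) ^ k * f x) ((x / 2) ^ k * (k / x * f x + f')) x := by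
  refine ((((hasDerivAt_id x).div_const 2).pow k).mul hf).congr_deriv ?_
  simp only [id, Pi.pow_apply]
  cases k with
  | zero => simp
  | succ k => simp only [Nat.add_sub_cancel, pow_succ]; field_simp

/-- The parameter `c` treats `J_k` (`c = -1/4`) and `I_k` (`c = 1/4`) together. -/
lemma mul_deriv_half_pow_mul_besselClifford (k : ℕ) (c x : ℝ) :
    x * deriv (fun x : ℝ => (x / 2) ^ k * besselClifford k (c * x ^ 2)) x =
      (x / 2) ^ k * (k * besselClifford k (c * x ^ 2)
        + 2 * c * x ^ 2 * besselClifford (k + 1) (c * x ^ 2)) := by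
  rcases eq_or_ne x 0 with rfl | hx
  · cases k <;> simp
  · rw [(hasDerivAt_half_pow_mul k hx (hasDerivAt_besselClifford_comp k c x)).deriv]
    field_simp

lemma hasDerivAt_mul_deriv_half_pow_mul_besselClifford (k : ℕ) (c : ℝ) {x : ℝ} (hx : x ≠ 0) :
    HasDerivAt (fun x => x * deriv (fun x : ℝ => (x / 2) ^ k * besselClifford k (c * x ^ 2)) x)
      ((k ^ 2 + 4 * c * x ^ 2) / x * ((x / 2) ^ k * besselClifford k (c * x ^ 2))) x := by
  rw [show (fun x => x * deriv (fun x : ℝ => (x / 2) ^ k * besselClifford k (c * x ^ 2)) x) = _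
    from funext (mul_deriv_half_pow_mul_besselClifford k c)]
  have hp : HasDerivAt (fun x : ℝ => 2 * c * x ^ 2) (2 * c * (2 * x)) x := by
    simpa using (hasDerivAt_pow 2 x).const_mul (2 * c)
  refine (hasDerivAt_half_pow_mul k hx
    (((hasDerivAt_besselClifford_comp k c x).const_mul (k : ℝ)).add
      (hp.mul (hasDerivAt_besselClifford_comp (k + 1) c x)))).congr_deriv ?_
  have hr := besselClifford_recurrence k (c * x ^ 2)
  simp only [Pi.add_apply, Pi.mul_apply, ← hr]
  field_simp
  ring

lemma besselJ_eq' (k : ℕ) :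
    besselJ k = fun x => (x / 2) ^ k * besselClifford k (-(1 / 4) * x ^ 2) := by
  funext x
  rw [besselJ_eq]
  ring_nf

lemma besselI_eq' (k : ℕ) :
    besselI k = fun x => (x / 2) ^ k * besselClifford k (1 / 4 * x ^ 2) := by
  funext x
  rw [besselI_eq]
  ring_nf

/-- Bessel's equation in the form `x (x J_k')' = (k² - x²) J_k`. -/
lemma hasDerivAt_mul_deriv_besselJ (k : ℕ) {x : ℝ} (hx : x ≠ 0) :
    HasDerivAt (fun x => x * deriv (besselJ k) x) ((k ^ 2 - x ^ 2) / x * besselJ k x) x := by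
  rw [besselJ_eq']
  refine (hasDerivAt_mul_deriv_half_pow_mul_besselClifford k _ hx).congr_deriv ?_
  ring_nf

/-- The modified Bessel equation in the form `x (x I_k')' = (k² + x²) I_k`. -/
lemma hasDerivAt_mul_deriv_besselI (k : ℕ) {x : ℝ} (hx : x ≠ 0) :
    HasDerivAt (fun x => x * deriv (besselI k) x) ((k ^ 2 + x ^ 2) / x * besselI k x) x := by
  rw [besselI_eq']
  refine (hasDerivAt_mul_deriv_half_pow_mul_besselClifford k _ hx).congr_deriv ?_
  ring_nf

/-! ### Positivity and energy estimates -/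

lemma besselClifford_pos_of_nonneg (k : ℕ) {z : ℝ} (hz : 0 ≤ z) : 0 < besselClifford k z := by
  refine (summable_besselClifford k z).tsum_pos (fun m => by positivity) 0 (by simp; positivity)

/-- The leading term `1/k!` dominates: a geometric series of ratio `1/4` bounds the tail by `1/(3
k!)`. -/
lemma besselClifford_pos_of_abs_le (k : ℕ) {z : ℝ} (hz : |z| ≤ 1 / 4) :
    0 < besselClifford k z := by
  have hs := summable_besselClifford k z
  have hg : HasSum (fun m : ℕ => (1 / (k.factorial : ℝ) * (1 / 4)) * (1 / 4) ^ m)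
      ((1 / (k.factorial : ℝ) * (1 / 4)) * (1 - 1 / 4)⁻¹) :=
    (hasSum_geometric_of_lt_one (by norm_num) (by norm_num)).mul_left _
  have hb := tsum_of_norm_bounded hg
    (f := fun m : ℕ => z ^ (m + 1) / (((m + 1).factorial : ℝ) * ((m + 1 + k).factorial : ℝ)))
    fun m => by
      rw [norm_div, norm_pow, Real.norm_eq_abs, Real.norm_of_nonneg (r := _ * _) (by positivity),
        mul_assoc, ← pow_succ', one_div_mul_eq_div]
      have h1 : (1 : ℝ) ≤ (m + 1).factorial := by
        exact_mod_cast Nat.factorial_pos _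
      have h2 : (k.factorial : ℝ) ≤ (m + 1 + k).factorial := by
        exact_mod_cast Nat.factorial_le (by omega)
      have h3 : |z| ^ (m + 1) ≤ (1 / 4) ^ (m + 1) := pow_le_pow_left₀ (abs_nonneg z) hz _
      refine div_le_div₀ (by positivity) h3 (by positivity) ?_
      nlinarith [show (0 : ℝ) < k.factorial by positivity]
  rw [besselClifford, hs.tsum_eq_zero_add]
  have h3 := (abs_le.1 hb).1
  have h4 : (0 : ℝ) < 1 / k.factorial := by positivity
  simp only [pow_zero, Nat.factorial_zero, Nat.cast_one, one_mul, zero_add]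
  nlinarith

lemma besselI_pos (k : ℕ) {x : ℝ} (hx : 0 < x) : 0 < besselI k x := by
  rw [besselI_eq]
  exact mul_pos (by positivity) (besselClifford_pos_of_nonneg k (by positivity))

lemma besselJ_pos_of_le_one (k : ℕ) {x : ℝ} (hx : 0 < x) (hx1 : x ≤ 1) : 0 < besselJ k x := by
  rw [besselJ_eq]
  refine mul_pos (by positivity) (besselClifford_pos_of_abs_le k ?_)
  rw [abs_neg, abs_of_nonneg (by positivity)]
  nlinarith

lemma continuous_besselJ (k : ℕ) : Continuous (besselJ k) := (contDiff_besselJ 0 k).continuous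

lemma continuous_besselI (k : ℕ) : Continuous (besselI k) := (contDiff_besselI 0 k).continuous

lemma contDiff_deriv_besselJ (k : ℕ) : ContDiff ℝ 1 (deriv (besselJ k)) :=
  (contDiff_succ_iff_deriv.1 (by exact_mod_cast contDiff_besselJ 2 k : ContDiff ℝ (1 + 1) _)).2.2

lemma contDiff_deriv_besselI (k : ℕ) : ContDiff ℝ 1 (deriv (besselI k)) :=
  (contDiff_succ_iff_deriv.1 (by exact_mod_cast contDiff_besselI 2 k : ContDiff ℝ (1 + 1) _)).2.2

lemma continuous_deriv_besselJ (k : ℕ) : Continuous (deriv (besselJ k)) :=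
  (contDiff_deriv_besselJ k).continuous

lemma continuous_deriv_besselI (k : ℕ) : Continuous (deriv (besselI k)) :=
  (contDiff_deriv_besselI k).continuous

lemma natCast_mul_besselJ_zero (k : ℕ) : (k : ℝ) * besselJ k 0 = 0 := by
  cases k <;> simp [besselJ_eq]

lemma natCast_mul_besselI_zero (k : ℕ) : (k : ℝ) * besselI k 0 = 0 := by
  cases k <;> simp [besselI_eq]

lemma hasDerivAt_besselJ_energy (k : ℕ) {x : ℝ} (hx : x ≠ 0) :
    HasDerivAt (fun x => (x * deriv (besselJ k) x) ^ 2 + (x ^ 2 - k ^ 2) * besselJ k x ^ 2)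
      (2 * x * besselJ k x ^ 2) x := by
  have h := ((hasDerivAt_mul_deriv_besselJ k hx).fun_pow 2).fun_add
    (((hasDerivAt_pow 2 x).sub_const ((k : ℝ) ^ 2)).fun_mul ((hasDerivAt_besselJ k x).fun_pow 2))
  refine h.congr_deriv ?_
  push_cast
  field_simp
  ring

lemma hasDerivAt_besselI_energy (k : ℕ) {x : ℝ} (hx : x ≠ 0) :
    HasDerivAt (fun x => (k ^ 2 + x ^ 2) * besselI k x ^ 2 - (x * deriv (besselI k) x) ^ 2)
      (2 * x * besselI k x ^ 2) x := by
  have h := (((hasDerivAt_pow 2 x).const_add ((k : ℝ) ^ 2)).fun_mul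
    ((hasDerivAt_besselI k x).fun_pow 2)).fun_sub ((hasDerivAt_mul_deriv_besselI k hx).fun_pow 2)
  refine h.congr_deriv ?_
  push_cast
  field_simp
  ring

/-- The energy vanishes at `0` and has derivative `2 x J_k² ≥ 0`. Strict growth is needed only near
`0`, where `J_k > 0` is known. -/
lemma besselJ_energy_pos (k : ℕ) {x : ℝ} (hx : 0 < x) :
    0 < (x * deriv (besselJ k) x) ^ 2 + (x ^ 2 - k ^ 2) * besselJ k x ^ 2 := by
  set A : ℝ → ℝ := fun x => (x * deriv (besselJ k) x) ^ 2 + (x ^ 2 - k ^ 2) * besselJ k x ^ 2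
  have hc : Continuous A := by
    have := continuous_besselJ k
    have := continuous_deriv_besselJ k
    fun_prop
  have h0 : A 0 = 0 := by
    have := natCast_mul_besselJ_zero k
    simp only [A]
    linear_combination -k * besselJ k 0 * this
  have hm : MonotoneOn A (Ici 0) := by
    refine monotoneOn_of_deriv_nonneg (convex_Ici 0) hc.continuousOn ?_ ?_
    all_goals
      intro y hy
      rw [interior_Ici] at hy
      have h := hasDerivAt_besselJ_energy k (ne_of_gt hy)
    · exact h.differentiableAt.differentiableWithinAt
    · rw [h.deriv]
      exact mul_nonneg (mul_nonneg zero_le_two (le_of_lt hy)) (sq_nonneg _)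
  have hs : StrictMonoOn A (Icc 0 1) := by
    refine strictMonoOn_of_deriv_pos (convex_Icc 0 1) hc.continuousOn fun y hy => ?_
    rw [interior_Icc] at hy
    rw [(hasDerivAt_besselJ_energy k (ne_of_gt hy.1)).deriv]
    have := besselJ_pos_of_le_one k hy.1 hy.2.le
    have := hy.1
    positivity
  have hmin : 0 < min x 1 := lt_min hx one_pos
  have h1 := hs ⟨le_rfl, zero_le_one⟩ ⟨hmin.le, min_le_right x 1⟩ hmin
  rw [h0] at h1
  exact h1.trans_le (hm hmin.le hx.le (min_le_left x 1))

lemma deriv_besselJ_ne_zero (k : ℕ) {x : ℝ} (hx : 0 < x) (h : besselJ k x = 0) :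
    deriv (besselJ k) x ≠ 0 := by
  intro h'
  have := besselJ_energy_pos k hx
  simp [h, h'] at this

lemma besselI_energy_pos (k : ℕ) {x : ℝ} (hx : 0 < x) :
    0 < (k ^ 2 + x ^ 2) * besselI k x ^ 2 - (x * deriv (besselI k) x) ^ 2 := by
  set A : ℝ → ℝ := fun x => (k ^ 2 + x ^ 2) * besselI k x ^ 2 - (x * deriv (besselI k) x) ^ 2
  have hc : Continuous A := by
    have := continuous_besselI k
    have := continuous_deriv_besselI k
    fun_prop
  have h0 : A 0 = 0 := by
    have := natCast_mul_besselI_zero k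
    simp only [A]
    linear_combination k * besselI k 0 * this
  have hs : StrictMonoOn A (Ici 0) := by
    refine strictMonoOn_of_deriv_pos (convex_Ici 0) hc.continuousOn fun y hy => ?_
    rw [interior_Ici] at hy
    rw [(hasDerivAt_besselI_energy k (ne_of_gt hy)).deriv]
    have := besselI_pos k hy
    have : 0 < y := hy
    positivity
  have h1 := hs (self_mem_Ici (a := (0 : ℝ))) hx.le hx
  rwa [h0] at h1

/-! ### Bounds on logarithmic derivatives -/

lemma HasDerivAt.nonpos_of_isMinOn_left {f : ℝ → ℝ} {f' a x : ℝ} (hf : HasDerivAt f f' x)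
    (hax : a < x) (hmin : ∀ y ∈ Ioo a x, f x ≤ f y) : f' ≤ 0 := by
  by_contra! h
  have h1 := (hasDerivWithinAt_iff_tendsto_slope' (by simp)).1 (hf.hasDerivWithinAt (s := Iio x))
  obtain ⟨y, hy, hy'⟩ := ((h1.eventually (lt_mem_nhds h)).and (Ioo_mem_nhdsLT hax)).exists
  rw [slope_def_field] at hy
  have := hmin y hy'
  exact absurd hy (not_lt.2 (div_nonpos_of_nonneg_of_nonpos (by linarith) (by linarith [hy'.2])))

/-- The logarithmic derivative `x I_k' / I_k` is at least `√(x² + (k + 1)²) - 1`. -/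
lemma sqrt_sub_one_mul_besselI_le (k : ℕ) {x : ℝ} (hx : 0 ≤ x) :
    (√(x ^ 2 + (k + 1) ^ 2) - 1) * besselI k x ≤ x * deriv (besselI k) x := by
  set E : ℝ → ℝ := fun x =>
    x * deriv (besselI k) x - (√(x ^ 2 + (k + 1) ^ 2) - 1) * besselI k x with hE
  have hc : Continuous E := by
    have := continuous_besselI k
    have := continuous_deriv_besselI k
    fun_prop
  have h0 : E 0 = 0 := by
    have h := natCast_mul_besselI_zero k
    have : √((0 : ℝ) ^ 2 + (k + 1) ^ 2) = k + 1 := by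
      rw [zero_pow two_ne_zero, zero_add, Real.sqrt_sq (by positivity)]
    simp only [hE, this]
    linear_combination -h
  by_contra! hneg
  -- At a negative minimum `y` of `E` the slope from the left is nonpositive, whereas `y E'(y) = (s
  -- - k - 1)² / s * I_k(y) - (s - 1) E(y) > 0`.
  obtain ⟨y, hy, hmin⟩ := isCompact_Icc.exists_isMinOn (nonempty_Icc.2 hx) hc.continuousOn
  have hyneg : E y < 0 := (hmin (right_mem_Icc.2 hx)).trans_lt (by simp only [hE]; linarith)
  have hy0 : 0 < y := hy.1.lt_of_ne (by rintro rfl; linarith)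
  set s := √(y ^ 2 + (k + 1) ^ 2) with hs
  have hs2 : s ^ 2 = y ^ 2 + (k + 1) ^ 2 := Real.sq_sqrt (by positivity)
  have hsk : (k : ℝ) + 1 < s := Real.lt_sqrt_of_sq_lt (by nlinarith)
  have hk : (0 : ℝ) ≤ k := k.cast_nonneg
  have hsd : HasDerivAt (fun x : ℝ => √(x ^ 2 + (k + 1) ^ 2)) (y / s) y := by
    refine (((hasDerivAt_pow 2 y).add_const ((k + 1 : ℝ) ^ 2)).sqrt (by positivity)).congr_deriv ?_
    rw [← hs]
    push_cast
    field_simp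
  have hd := (hasDerivAt_mul_deriv_besselI k hy0.ne').fun_sub
    ((hsd.sub_const 1).fun_mul (hasDerivAt_besselI k y))
  have hle := hd.nonpos_of_isMinOn_left hy0 fun z hz => hmin ⟨hz.1.le, hz.2.le.trans hy.2⟩
  have hI := besselI_pos k hy0
  have hEy : E y = y * deriv (besselI k) y - (s - 1) * besselI k y := rfl
  rw [hEy] at hyneg
  have hs0 : s ≠ 0 := by linarith
  have hfac : (k ^ 2 + y ^ 2) - y ^ 2 / s - (s - 1) ^ 2 = (s - k - 1) ^ 2 / s := by
    have : y ^ 2 = s ^ 2 - (k + 1) ^ 2 := by linarith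
    rw [this]
    field_simp
    ring
  have hmul : y * ((k ^ 2 + y ^ 2) / y * besselI k y
      - (y / s * besselI k y + (s - 1) * deriv (besselI k) y))
      = ((k ^ 2 + y ^ 2) - y ^ 2 / s - (s - 1) ^ 2) * besselI k y
        - (s - 1) * (y * deriv (besselI k) y - (s - 1) * besselI k y) := by
    field_simp
    ring
  rw [hfac] at hmul
  have h1 : 0 ≤ (s - k - 1) ^ 2 / s * besselI k y := by positivity
  have h2 := mul_nonpos_of_nonneg_of_nonpos hy0.le hle
  rw [hmul] at h2
  nlinarith

lemma natCast_mul_besselI_lt (k : ℕ) {x : ℝ} (hx : 0 < x) :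
    k * besselI k x < x * deriv (besselI k) x := by
  have hsk : (k : ℝ) + 1 < √(x ^ 2 + (k + 1) ^ 2) := Real.lt_sqrt_of_sq_lt (by nlinarith)
  have h := sqrt_sub_one_mul_besselI_le k hx.le
  have := besselI_pos k hx
  nlinarith

/-- The weight `x ^ k` makes the derivative of `E` collapse to `-x ^ (k + 1) J_k`. -/
lemma mul_deriv_besselJ_lt (k : ℕ) {x : ℝ} (hx : 0 < x) (hpos : ∀ y ∈ Ioo 0 x, 0 < besselJ k y) :
    x * deriv (besselJ k) x < k * besselJ k x := by
  set E : ℝ → ℝ := fun x => x ^ k * (x * deriv (besselJ k) x - k * besselJ k x) with hE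
  have hc : Continuous E := by
    have := continuous_besselJ k
    have := continuous_deriv_besselJ k
    fun_prop
  have h0 : E 0 = 0 := by
    have h := natCast_mul_besselJ_zero k
    simp only [hE]
    rw [h]
    simp
  have hs : StrictAntiOn E (Icc 0 x) := by
    refine strictAntiOn_of_deriv_neg (convex_Icc 0 x) hc.continuousOn fun y hy => ?_
    rw [interior_Icc] at hy
    have hy0 : 0 < y := hy.1
    have hd := (hasDerivAt_pow k y).fun_mul ((hasDerivAt_mul_deriv_besselJ k hy0.ne').fun_sub
      ((hasDerivAt_besselJ k y).const_mul (k : ℝ)))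
    have he : k * y ^ (k - 1) * (y * deriv (besselJ k) y - k * besselJ k y)
        + y ^ k * ((k ^ 2 - y ^ 2) / y * besselJ k y - k * deriv (besselJ k) y)
        = -(y ^ k * y * besselJ k y) := by
      cases k with
      | zero => simp; field_simp
      | succ k => simp only [Nat.add_sub_cancel, pow_succ]; push_cast; field_simp; ring
    rw [hd.deriv, he, neg_lt_zero]
    have := hpos y hy
    positivity
  have h1 := hs (left_mem_Icc.2 hx.le) (right_mem_Icc.2 hx.le) hx
  rw [h0] at h1
  have := neg_of_mul_neg_right h1 (pow_pos hx k).le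
  linarith

/-! ### Oscillation and the zeros of `J_k` -/

lemma pos_or_neg_of_ne_zero {f : ℝ → ℝ} {s : Set ℝ} (hf : ContinuousOn f s) (hs : s.OrdConnected)
    (h : ∀ x ∈ s, f x ≠ 0) : (∀ x ∈ s, 0 < f x) ∨ ∀ x ∈ s, f x < 0 := by
  by_contra! hcon
  obtain ⟨⟨x, hx, hfx⟩, y, hy, hfy⟩ := hcon
  obtain ⟨z, hz, hz0⟩ := hs.isPreconnected.intermediate_value hx hy hf ⟨hfx, hfy⟩
  exact h z hz hz0

/-- `J_k` oscillates: it has arbitrarily large zeros. -/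
lemma exists_besselJ_eq_zero_gt (k : ℕ) (a : ℝ) : ∃ x, a < x ∧ besselJ k x = 0 := by
  by_contra! hne
  obtain ⟨b, hb0, hab, hkb⟩ : ∃ b : ℝ, 0 < b ∧ a < b ∧ (k : ℝ) + 1 ≤ b :=
    ⟨max (|a| + 1) (k + 1), lt_max_of_lt_left (by positivity),
      lt_max_of_lt_left (by linarith [le_abs_self a]), le_max_right _ _⟩
  -- Sturm comparison with `v = sin (log (x / b))`, which solves `x (x v')' = -v`; `W` is the
  -- weighted Wronskian over the half period `[b, b e^π]`. Since `b ≥ k + 1`, a constant sign of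
  -- `J_k` makes `W` monotone in the direction opposite to its boundary values `-J_k(b)`, `J_k(d)`.
  set W : ℝ → ℝ := fun x => x * deriv (besselJ k) x * Real.sin (Real.log (x / b))
    - besselJ k x * Real.cos (Real.log (x / b)) with hW
  have hk : (0 : ℝ) ≤ k := k.cast_nonneg
  set d := b * Real.exp Real.pi with hd
  have hbd : b < d := by
    have : 1 < Real.exp Real.pi := Real.one_lt_exp_iff.2 Real.pi_pos
    nlinarith
  have hder : ∀ x ∈ Icc b d, HasDerivAt W
      (-(Real.sin (Real.log (x / b)) * ((x ^ 2 - k ^ 2 - 1) / x) * besselJ k x)) x := by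
    intro x hx
    have hx0 : 0 < x := hb0.trans_le hx.1
    have hl : HasDerivAt (fun x : ℝ => Real.log (x / b)) (1 / x) x := by
      refine (((hasDerivAt_id x).div_const b).log (by simp; constructor <;> positivity)).congr_deriv ?_
      simp
      field_simp
    refine (((hasDerivAt_mul_deriv_besselJ k hx0.ne').fun_mul hl.sin).fun_sub
      ((hasDerivAt_besselJ k x).fun_mul hl.cos)).congr_deriv ?_
    field_simp
    ring
  have hcoef : ∀ x ∈ Icc b d, 0 ≤ Real.sin (Real.log (x / b)) * ((x ^ 2 - k ^ 2 - 1) / x) := by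
    intro x hx
    have hx0 : 0 < x := hb0.trans_le hx.1
    have h1 : 0 ≤ Real.log (x / b) := Real.log_nonneg ((one_le_div hb0).2 hx.1)
    have h2 : Real.log (x / b) ≤ Real.pi := by
      rw [Real.log_le_iff_le_exp (by positivity), div_le_iff₀ hb0, mul_comm]
      exact hx.2
    refine mul_nonneg (Real.sin_nonneg_of_nonneg_of_le_pi h1 h2) (div_nonneg ?_ hx0.le)
    nlinarith [hx.1]
  have hWb : W b = -besselJ k b := by simp [hW, hb0.ne']
  have hWd : W d = besselJ k d := by
    have : Real.log (d / b) = Real.pi := by rw [hd, mul_div_cancel_left₀ _ hb0.ne', Real.log_exp]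
    simp [hW, this]
  have hcont : ContinuousOn W (Icc b d) := fun x hx => (hder x hx).continuousAt.continuousWithinAt
  have hbm : b ∈ Icc b d := left_mem_Icc.2 hbd.le
  have hdm : d ∈ Icc b d := right_mem_Icc.2 hbd.le
  rcases pos_or_neg_of_ne_zero (continuous_besselJ k).continuousOn ordConnected_Ioi (s := Ioi a)
    fun x hx => hne x hx with h | h
  · have hanti : AntitoneOn W (Icc b d) := by
      refine antitoneOn_of_deriv_nonpos (convex_Icc b d) hcont ?_ ?_ <;> intro x hx
        <;> have hx' := interior_subset hx
      · exact (hder x hx').differentiableAt.differentiableWithinAt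
      · rw [(hder x hx').deriv, neg_nonpos]
        exact mul_nonneg (hcoef x hx') (h x (hab.trans_le hx'.1)).le
    have := hanti hbm hdm hbd.le
    linarith [h b hab, h d (hab.trans hbd)]
  · have hmono : MonotoneOn W (Icc b d) := by
      refine monotoneOn_of_deriv_nonneg (convex_Icc b d) hcont ?_ ?_ <;> intro x hx
        <;> have hx' := interior_subset hx
      · exact (hder x hx').differentiableAt.differentiableWithinAt
      · rw [(hder x hx').deriv, neg_nonneg]
        exact mul_nonpos_of_nonneg_of_nonpos (hcoef x hx') (h x (hab.trans_le hx'.1)).le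
    have := hmono hbm hdm hbd.le
    linarith [h b hab, h d (hab.trans hbd)]

lemma eventually_besselJ_ne_zero (k : ℕ) {x : ℝ} (hx : 0 < x) (h : besselJ k x = 0) :
    ∀ᶠ y in 𝓝[≠] x, besselJ k y ≠ 0 :=
  (hasDerivAt_besselJ k x).eventually_ne (deriv_besselJ_ne_zero k hx h)

/-- Zeros do not accumulate at `a` from the right, so the set is closed and its infimum is attained.
-/
lemma exists_isLeast_besselJ_zero_gt (k : ℕ) {a : ℝ} (ha : a = 0 ∨ 0 < a ∧ besselJ k a = 0) :
    ∃ b, IsLeast {x | a < x ∧ besselJ k x = 0} b := by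
  have hev : ∀ᶠ y in 𝓝[>] a, besselJ k y ≠ 0 := by
    rcases ha with rfl | ⟨ha, h⟩
    · filter_upwards [Ioo_mem_nhdsGT one_pos] with y hy
      exact (besselJ_pos_of_le_one k hy.1 hy.2.le).ne'
    · exact (eventually_besselJ_ne_zero k ha h).filter_mono (nhdsWithin_mono _ fun y hy => ne_of_gt hy)
  obtain ⟨c, hc, hsub⟩ := mem_nhdsGT_iff_exists_Ioo_subset.1 hev
  have heq : {x | a < x ∧ besselJ k x = 0} = Ici c ∩ besselJ k ⁻¹' {0} := by
    ext x
    refine ⟨fun hx => ⟨not_lt.1 fun hxc => hsub ⟨hx.1, hxc⟩ hx.2, hx.2⟩,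
      fun hx => ⟨lt_of_lt_of_le hc hx.1, hx.2⟩⟩
  refine ⟨sInf {x | a < x ∧ besselJ k x = 0}, ?_, ?_⟩
  · have hcl : IsClosed {x | a < x ∧ besselJ k x = 0} := by
      rw [heq]
      exact isClosed_Ici.inter (isClosed_singleton.preimage (continuous_besselJ k))
    exact hcl.csInf_mem (exists_besselJ_eq_zero_gt k a) ⟨a, fun x hx => hx.1.le⟩
  · exact fun x hx => csInf_le ⟨a, fun x hx => hx.1.le⟩ hx

/-- The positive zeros of `J_k` in increasing order, numbered from `0`. -/
noncomputable def besselJZero (k : ℕ) : ℕ → ℝ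
  | 0 => sInf {x | 0 < x ∧ besselJ k x = 0}
  | n + 1 => sInf {x | besselJZero k n < x ∧ besselJ k x = 0}

lemma isLeast_besselJZero_zero (k : ℕ) :
    IsLeast {x | 0 < x ∧ besselJ k x = 0} (besselJZero k 0) := by
  obtain ⟨b, hb⟩ := exists_isLeast_besselJ_zero_gt k (Or.inl rfl)
  rwa [besselJZero, hb.csInf_eq]

lemma besselJZero_pos_and_eq_zero (k n : ℕ) :
    0 < besselJZero k n ∧ besselJ k (besselJZero k n) = 0 := by
  induction n with
  | zero => exact (isLeast_besselJZero_zero k).1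
  | succ n ih =>
    obtain ⟨b, hb⟩ := exists_isLeast_besselJ_zero_gt k (Or.inr ih)
    rw [besselJZero, hb.csInf_eq]
    exact ⟨ih.1.trans hb.1.1, hb.1.2⟩

lemma besselJZero_pos (k n : ℕ) : 0 < besselJZero k n := (besselJZero_pos_and_eq_zero k n).1

lemma besselJ_besselJZero (k n : ℕ) : besselJ k (besselJZero k n) = 0 :=
  (besselJZero_pos_and_eq_zero k n).2

lemma isLeast_besselJZero_succ (k n : ℕ) :
    IsLeast {x | besselJZero k n < x ∧ besselJ k x = 0} (besselJZero k (n + 1)) := by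
  obtain ⟨b, hb⟩ := exists_isLeast_besselJ_zero_gt k (Or.inr (besselJZero_pos_and_eq_zero k n))
  rwa [besselJZero, hb.csInf_eq]

lemma strictMono_besselJZero (k : ℕ) : StrictMono (besselJZero k) :=
  strictMono_nat_of_lt_succ fun n => (isLeast_besselJZero_succ k n).1.1

lemma besselJ_ne_zero_of_mem_Ioo (k n : ℕ) {x : ℝ}
    (hx : x ∈ Ioo (besselJZero k n) (besselJZero k (n + 1))) : besselJ k x ≠ 0 :=
  fun h => hx.2.not_ge ((isLeast_besselJZero_succ k n).2 ⟨hx.1, h⟩)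

lemma besselJ_pos_of_lt_besselJZero (k : ℕ) {x : ℝ} (hx : 0 < x) (hx' : x < besselJZero k 0) :
    0 < besselJ k x := by
  rcases pos_or_neg_of_ne_zero (continuous_besselJ k).continuousOn
    (ordConnected_Ioo (a := 0) (b := besselJZero k 0))
    fun y hy h => hy.2.not_ge ((isLeast_besselJZero_zero k).2 ⟨hy.1, h⟩) with h | h
  · exact h x ⟨hx, hx'⟩
  · have := h (min x 1) ⟨lt_min hx one_pos, (min_le_left _ _).trans_lt hx'⟩
    exact absurd this (besselJ_pos_of_le_one k (lt_min hx one_pos) (min_le_right _ _)).not_gt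

/-- A finite supremum would be a nonisolated positive zero, contradicting simplicity. -/
lemma exists_lt_besselJZero (k : ℕ) (x : ℝ) : ∃ n, x < besselJZero k n := by
  by_contra! hle
  have hbdd : BddAbove (range (besselJZero k)) := ⟨x, by rintro _ ⟨n, rfl⟩; exact hle n⟩
  have ht := tendsto_atTop_ciSup (strictMono_besselJZero k).monotone hbdd
  set c := ⨆ n, besselJZero k n
  have hlt : ∀ n, besselJZero k n < c := fun n =>
    (strictMono_besselJZero k n.lt_succ_self).trans_le (le_ciSup hbdd (n + 1))
  have hc0 : besselJ k c = 0 := by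
    refine tendsto_nhds_unique (((continuous_besselJ k).tendsto c).comp ht) ?_
    simp [Function.comp_def, besselJ_besselJZero]
  have ht' : Tendsto (besselJZero k) atTop (𝓝[≠] c) :=
    tendsto_nhdsWithin_iff.2 ⟨ht, .of_forall fun n => (hlt n).ne⟩
  obtain ⟨n, hn⟩ := (ht'.eventually
    (eventually_besselJ_ne_zero k ((besselJZero_pos k 0).trans (hlt 0)) hc0)).exists
  exact hn (besselJ_besselJZero k n)

/-! ### Signs of `F_k` and of its partial derivatives at roots -/

lemma bucklingF_eq (k : ℕ) (κ : ℝ) :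
    bucklingF k κ = fun α => besselJ k α * (κ / α * deriv (besselI k) (κ / α))
      - besselI k (κ / α) * (α * deriv (besselJ k) α) := by
  funext α
  rw [bucklingF]
  ring

lemma bucklingF_pos (k : ℕ) {κ α : ℝ} (hκ : 0 < κ) (hα : 0 < α)
    (hpos : ∀ y ∈ Ioo 0 α, 0 < besselJ k y) (hJ : 0 ≤ besselJ k α) : 0 < bucklingF k κ α := by
  have hI := besselI_pos k (div_pos hκ hα)
  have h1 := natCast_mul_besselI_lt k (div_pos hκ hα)
  have h2 := mul_deriv_besselJ_lt k hα hpos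
  rw [bucklingF_eq]
  have h3 := mul_lt_mul_of_pos_left h2 hI
  have h4 := mul_le_mul_of_nonneg_left h1.le hJ
  simp only
  linarith

lemma one_lt_of_bucklingF_eq_zero (k : ℕ) {κ α : ℝ} (hκ : 0 < κ) (hα : 0 < α)
    (h : bucklingF k κ α = 0) : 1 < α := by
  by_contra! hle
  exact (bucklingF_pos k hκ hα (fun y hy => besselJ_pos_of_le_one k hy.1 (hy.2.le.trans hle))
    (besselJ_pos_of_le_one k hα hle).le).ne' h

/-- At a zero of `F_k(·, κ)`, the partial derivative in `α` has the sign of `J_k(α)`. -/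
lemma exists_hasDerivAt_bucklingF_right (k : ℕ) {κ α : ℝ} (hκ : 0 < κ) (hα : 0 < α)
    (hJ : besselJ k α ≠ 0) (hF : bucklingF k κ α = 0) :
    ∃ F', HasDerivAt (bucklingF k κ) F' α ∧ 0 < besselJ k α * F' := by
  have hα1 := one_lt_of_bucklingF_eq_zero k hκ hα hF
  have hy0 : 0 < κ / α := div_pos hκ hα
  have hdiv : HasDerivAt (fun α : ℝ => κ / α) (-(κ / α) / α) α := by
    refine (((hasDerivAt_id α).inv hα.ne').const_mul κ).congr_deriv ?_
    simp
    field_simp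
  have hP := (hasDerivAt_mul_deriv_besselI k hy0.ne').comp α hdiv
  have hI := (hasDerivAt_besselI k (κ / α)).comp α hdiv
  have hd := ((hasDerivAt_besselJ k α).fun_mul hP).fun_sub
    (hI.fun_mul (hasDerivAt_mul_deriv_besselJ k hα.ne'))
  rw [bucklingF_eq] at hF ⊢
  refine ⟨_, hd, ?_⟩
  simp only [Function.comp] at hF ⊢
  have hIpos := besselI_pos k hy0
  have hle := sqrt_sub_one_mul_besselI_le k hy0.le
  set y := κ / α
  set P := y * deriv (besselI k) y with hPdef
  set Q := α * deriv (besselJ k) α with hQdef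
  set s := √(y ^ 2 + (k + 1) ^ 2) with hs
  have hs2 : s ^ 2 = y ^ 2 + (k + 1) ^ 2 := Real.sq_sqrt (by positivity)
  have hsk : (k : ℝ) + 1 < s := Real.lt_sqrt_of_sq_lt (by nlinarith)
  have hk : (0 : ℝ) ≤ k := k.cast_nonneg
  set I := besselI k y
  set J := besselJ k α
  have hkey : (α * I) * (J * (deriv (besselJ k) α * P + J * ((k ^ 2 + y ^ 2) / y * I * (-y / α))
      - (deriv (besselI k) y * (-y / α) * Q + I * ((k ^ 2 - α ^ 2) / α * J))))
      = J ^ 2 * (2 * P ^ 2 - (y ^ 2 + 2 * k ^ 2 - α ^ 2) * I ^ 2) := by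
    have h1 : (α * I) * (J * (deriv (besselJ k) α * P + J * ((k ^ 2 + y ^ 2) / y * I * (-y / α))
      - (deriv (besselI k) y * (-y / α) * Q + I * ((k ^ 2 - α ^ 2) / α * J))))
      = I * J * (Q * P - J * (k ^ 2 + y ^ 2) * I + P * Q - (k ^ 2 - α ^ 2) * I * J) := by
      rw [hPdef, hQdef]
      field_simp
      ring
    rw [h1]
    linear_combination -2 * P * J * hF
  have hPsq : ((s - 1) * I) ^ 2 ≤ P ^ 2 :=
    pow_le_pow_left₀ (mul_nonneg (by linarith) hIpos.le) hle 2
  -- Only `k = 0` needs `α > 1`; for `k ≥ 1`, `s - 2 > k - 1 ≥ 0`.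
  have hnum : 0 < 2 * (s - 1) ^ 2 - (y ^ 2 + 2 * k ^ 2 - α ^ 2) := by
    have h1 : 2 * (s - 1) ^ 2 - (y ^ 2 + 2 * k ^ 2 - α ^ 2)
        = (s - 2) ^ 2 - (k - 1) ^ 2 + α ^ 2 := by
      rw [show y ^ 2 = s ^ 2 - (k + 1) ^ 2 by linarith]
      ring
    rw [h1]
    rcases Nat.eq_zero_or_pos k with rfl | hk1
    · push_cast
      nlinarith [sq_nonneg (s - 2)]
    · have hk1' : (1 : ℝ) ≤ k := by exact_mod_cast hk1
      nlinarith
  have hpos : 0 < J ^ 2 * (2 * P ^ 2 - (y ^ 2 + 2 * k ^ 2 - α ^ 2) * I ^ 2) := by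
    refine mul_pos (by positivity) ?_
    nlinarith [mul_pos hnum (pow_pos hIpos 2)]
  rw [← hkey] at hpos
  exact pos_of_mul_pos_right hpos (by positivity)

/-- At a zero of `F_k(α, ·)`, the partial derivative in `κ` has the sign of `J_k(α)`. -/
lemma exists_hasDerivAt_bucklingF_left (k : ℕ) {κ α : ℝ} (hκ : 0 < κ) (hα : 0 < α)
    (hJ : besselJ k α ≠ 0) (hF : bucklingF k κ α = 0) :
    ∃ F', HasDerivAt (fun κ => bucklingF k κ α) F' κ ∧ 0 < besselJ k α * F' := by
  have hy0 : 0 < κ / α := div_pos hκ hα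
  have hdiv : HasDerivAt (fun κ : ℝ => κ / α) (1 / α) κ := (hasDerivAt_id κ).div_const α
  have hP := (hasDerivAt_mul_deriv_besselI k hy0.ne').comp κ hdiv
  have hI := (hasDerivAt_besselI k (κ / α)).comp κ hdiv
  have hd := (hP.const_mul (besselJ k α)).fun_sub (hI.mul_const (α * deriv (besselJ k) α))
  simp only [bucklingF_eq] at hF ⊢
  refine ⟨_, hd, ?_⟩
  have hIpos := besselI_pos k hy0
  have hB := besselI_energy_pos k hy0
  set y := κ / α
  set J := besselJ k α
  have hkey : (α * y * besselI k y) * (J * (J * ((k ^ 2 + y ^ 2) / y * besselI k y * (1 / α))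
      - deriv (besselI k) y * (1 / α) * (α * deriv (besselJ k) α)))
      = J ^ 2 * ((k ^ 2 + y ^ 2) * besselI k y ^ 2 - (y * deriv (besselI k) y) ^ 2) := by
    field_simp
    linear_combination (y * deriv (besselI k) y) * hF
  have hpos := mul_pos (pow_pos (abs_pos.2 hJ) 2) hB
  rw [sq_abs, ← hkey] at hpos
  exact pos_of_mul_pos_right hpos (by positivity)

lemma contDiffAt_bucklingF (k : ℕ) {u : ℝ × ℝ} (hu : u.2 ≠ 0) :
    ContDiffAt ℝ 1 (fun v : ℝ × ℝ => bucklingF k v.1 v.2) u := by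
  have hdiv : ContDiffAt ℝ 1 (fun v : ℝ × ℝ => v.1 / v.2) u := contDiffAt_fst.div contDiffAt_snd hu
  have hJ := (contDiff_besselJ 1 k).contDiffAt.comp u contDiffAt_snd
  have hJ' := (contDiff_deriv_besselJ k).contDiffAt.comp u contDiffAt_snd
  have hI := (contDiff_besselI 1 k).contDiffAt.comp u hdiv
  have hI' := (contDiff_deriv_besselI k).contDiffAt.comp u hdiv
  exact ((hdiv.mul hJ).mul hI').sub ((contDiffAt_snd.mul hI).mul hJ')

lemma continuousOn_bucklingF (k : ℕ) (κ : ℝ) : ContinuousOn (bucklingF k κ) (Ioi 0) := fun α hα =>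
  ((contDiffAt_bucklingF k (u := (κ, α)) (ne_of_gt hα)).continuousAt.comp
    (f := fun α : ℝ => (κ, α)) (by fun_prop)).continuousWithinAt

/-! ### Implicit functions and one-variable crossing arguments -/

/-- Two-variable implicit function theorem, with the formula for the derivative. -/
lemma exists_implicit_function {f : ℝ × ℝ → ℝ} {a b fx fy : ℝ} (hf : ContDiffAt ℝ 1 f (a, b))
    (hx : HasDerivAt (fun x => f (x, b)) fx a) (hy : HasDerivAt (fun y => f (a, y)) fy b)
    (hne : fy ≠ 0) :
    ∃ φ : ℝ → ℝ, ContDiffAt ℝ 1 φ a ∧ φ a = b ∧ (∀ᶠ x in 𝓝 a, f (x, φ x) = f (a, b)) ∧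
      deriv φ a = -fx / fy := by
  have hfd := (hf.differentiableAt one_ne_zero).hasFDerivAt
  have hX : fderiv ℝ f (a, b) (1, 0) = fx :=
    (hfd.comp_hasDerivAt (f := fun x : ℝ => (x, b)) a
      ((hasDerivAt_id a).prodMk (hasDerivAt_const a b))).unique hx
  have hY : fderiv ℝ f (a, b) (0, 1) = fy :=
    (hfd.comp_hasDerivAt (f := fun y : ℝ => (a, y)) b
      ((hasDerivAt_const b a).prodMk (hasDerivAt_id b))).unique hy
  have hinv : (fderiv ℝ f (a, b) ∘L .inr ℝ ℝ ℝ).IsInvertible := by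
    refine ⟨ContinuousLinearEquiv.unitsEquivAut ℝ (Units.mk0 fy hne), ?_⟩
    ext
    simp [hY]
  refine ⟨hf.implicitFunction one_ne_zero hinv, hf.contDiffAt_implicitFunction one_ne_zero hinv,
    hf.implicitFunction_apply_self one_ne_zero hinv,
    hf.eventually_apply_implicitFunction one_ne_zero hinv, ?_⟩
  have hev := hf.eventually_apply_implicitFunction one_ne_zero hinv
  have hφd := ((hf.contDiffAt_implicitFunction one_ne_zero hinv).differentiableAt
    one_ne_zero).hasDerivAt
  have hφa := hf.implicitFunction_apply_self one_ne_zero hinv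
  simp only at hev hφd hφa
  set φ := hf.implicitFunction one_ne_zero hinv
  have hfd' : HasFDerivAt f (fderiv ℝ f (a, b)) (a, φ a) := by rwa [hφa]
  have hc := hfd'.comp_hasDerivAt (f := fun x : ℝ => (x, φ x)) a ((hasDerivAt_id a).prodMk hφd)
  have hz : HasDerivAt (fun x => f (x, φ x)) 0 a :=
    (hasDerivAt_const a (f (a, b))).congr_of_eventuallyEq hev
  have h := hc.unique hz
  rw [show ((1 : ℝ), deriv φ a) = (1, 0) + deriv φ a • ((0 : ℝ), (1 : ℝ)) by simp, map_add,
    map_smul, hX, hY, smul_eq_mul] at h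
  rw [eq_div_iff hne]
  linarith

lemma HasDerivAt.nonneg_of_isMinOn_right {f : ℝ → ℝ} {f' x b : ℝ} (hf : HasDerivAt f f' x)
    (hxb : x < b) (hmin : ∀ y ∈ Ioo x b, f x ≤ f y) : 0 ≤ f' := by
  have h : HasDerivAt (fun y => f (-y)) (-f') (-x) := by
    have := (show HasDerivAt f f' (- -x) by rwa [neg_neg]).comp (-x) (hasDerivAt_neg (-x))
    simpa [Function.comp_def] using this
  have := h.nonpos_of_isMinOn_left (a := -b) (by linarith) fun y hy => by
    rw [neg_neg]
    exact hmin _ ⟨by linarith [hy.2], by linarith [hy.1]⟩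
  linarith

lemma HasDerivAt.mul_neg_of_consecutive_zeros {f : ℝ → ℝ} {a b fa fb : ℝ} (hab : a < b)
    (hc : Continuous f) (ha : HasDerivAt f fa a) (hb : HasDerivAt f fb b) (ha0 : f a = 0)
    (hb0 : f b = 0) (hne : ∀ x ∈ Ioo a b, f x ≠ 0) (hfa : fa ≠ 0) (hfb : fb ≠ 0) :
    fa * fb < 0 := by
  rcases pos_or_neg_of_ne_zero hc.continuousOn ordConnected_Ioo hne with h | h
  · have h1 := ha.nonneg_of_isMinOn_right hab fun y hy => by rw [ha0]; exact (h y hy).le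
    have h2 := hb.nonpos_of_isMinOn_left hab fun y hy => by rw [hb0]; exact (h y hy).le
    exact mul_neg_of_pos_of_neg (h1.lt_of_ne' hfa) (h2.lt_of_ne hfb)
  · have h1 := ha.fun_neg.nonneg_of_isMinOn_right hab fun y hy => by
      rw [ha0, neg_zero]; exact (neg_pos.2 (h y hy)).le
    have h2 := hb.fun_neg.nonpos_of_isMinOn_left hab fun y hy => by
      rw [hb0, neg_zero]; exact (neg_pos.2 (h y hy)).le
    exact mul_neg_of_neg_of_pos ((neg_nonneg.1 h1).lt_of_ne hfa) ((neg_nonpos.1 h2).lt_of_ne' hfb)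

/-- Since every zero is an upward crossing, `f` stays nonnegative after `r`, and so can only reach
zero at `s` with nonpositive slope. -/
lemma not_two_zeros_of_deriv_pos {f : ℝ → ℝ} {r s : ℝ} (hrs : r < s)
    (hd : ∀ x ∈ Icc r s, DifferentiableAt ℝ f x) (hr : f r = 0) (hs : f s = 0)
    (hpos : ∀ x ∈ Icc r s, f x = 0 → 0 < deriv f x) : False := by
  have hle : ∀ x ∈ Icc r s, -f x ≤ 0 := by
    refine image_le_of_deriv_right_lt_deriv_boundary (f' := fun x => -deriv f x) (B := fun _ => 0)
      (B' := fun _ => 0) (fun x hx => (hd x hx).continuousAt.neg.continuousWithinAt)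
      (fun x hx => (hd x (Ico_subset_Icc_self hx)).hasDerivAt.fun_neg.hasDerivWithinAt)
      (by simp [hr]) (fun x => hasDerivAt_const x 0) fun x hx h0 => ?_
    exact neg_lt_zero.2 (hpos x (Ico_subset_Icc_self hx) (neg_eq_zero.1 h0))
  have hsm := right_mem_Icc.2 hrs.le
  refine (hpos s hsm hs).not_ge ((hd s hsm).hasDerivAt.nonpos_of_isMinOn_left hrs fun y hy => ?_)
  linarith [hle y (Ioo_subset_Icc_self hy)]

/-! ### One root in each gap between zeros of `J_k` -/

lemma bucklingF_besselJZero_ne_zero (k n : ℕ) {κ : ℝ} (hκ : 0 < κ) :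
    bucklingF k κ (besselJZero k n) ≠ 0 := by
  have hj := besselJZero_pos k n
  have hd := deriv_besselJ_ne_zero k hj (besselJ_besselJZero k n)
  have hI := besselI_pos k (div_pos hκ hj)
  rw [bucklingF, besselJ_besselJZero]
  simp [hd, hI.ne', hj.ne']

lemma exists_bucklingF_eq_zero (k n : ℕ) {κ : ℝ} (hκ : 0 < κ) :
    ∃ x ∈ Ioo (besselJZero k n) (besselJZero k (n + 1)), bucklingF k κ x = 0 := by
  have hj := besselJZero_pos k n
  have hj' := besselJZero_pos k (n + 1)
  have hlt := strictMono_besselJZero k n.lt_succ_self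
  have hprod := HasDerivAt.mul_neg_of_consecutive_zeros hlt (continuous_besselJ k)
    (hasDerivAt_besselJ k _) (hasDerivAt_besselJ k _) (besselJ_besselJZero k n)
    (besselJ_besselJZero k (n + 1)) (fun x hx => besselJ_ne_zero_of_mem_Ioo k n hx)
    (deriv_besselJ_ne_zero k hj (besselJ_besselJZero k n))
    (deriv_besselJ_ne_zero k hj' (besselJ_besselJZero k (n + 1)))
  have hF : bucklingF k κ (besselJZero k n) * bucklingF k κ (besselJZero k (n + 1)) < 0 := by
    have hI := besselI_pos k (div_pos hκ hj)
    have hI' := besselI_pos k (div_pos hκ hj')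
    simp only [bucklingF, besselJ_besselJZero]
    have hc : 0 < besselJZero k n * besselI k (κ / besselJZero k n)
      * (besselJZero k (n + 1) * besselI k (κ / besselJZero k (n + 1))) := by positivity
    have := mul_neg_of_pos_of_neg hc hprod
    simp only [Nat.succ_eq_add_one] at this
    linarith
  by_contra! hne
  have hsub : Icc (besselJZero k n) (besselJZero k (n + 1)) ⊆ Ioi 0 :=
    fun x hx => hj.trans_le hx.1
  have hne' : ∀ x ∈ Icc (besselJZero k n) (besselJZero k (n + 1)), bucklingF k κ x ≠ 0 := by
    intro x hx
    rcases hx.1.eq_or_lt with rfl | h1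
    · exact bucklingF_besselJZero_ne_zero k n hκ
    rcases hx.2.eq_or_lt with rfl | h2
    · exact bucklingF_besselJZero_ne_zero k (n + 1) hκ
    exact hne x ⟨h1, h2⟩
  have hl := left_mem_Icc.2 hlt.le
  have hr := right_mem_Icc.2 hlt.le
  rcases pos_or_neg_of_ne_zero ((continuousOn_bucklingF k κ).mono hsub) ordConnected_Icc hne'
    with h | h
  · exact hF.not_gt (mul_pos (h _ hl) (h _ hr))
  · exact hF.not_gt (mul_pos_of_neg_of_neg (h _ hl) (h _ hr))

/-- `J_k` has constant sign on the gap, so all zeros of `F_k` there are crossed in the same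
direction. -/
lemma bucklingF_zero_not_lt (k n : ℕ) {κ r s : ℝ} (hκ : 0 < κ)
    (hr : r ∈ Ioo (besselJZero k n) (besselJZero k (n + 1))) (hFr : bucklingF k κ r = 0)
    (hs : s ∈ Ioo (besselJZero k n) (besselJZero k (n + 1))) (hFs : bucklingF k κ s = 0) :
    ¬ r < s := by
  intro hrs
  have hmem : ∀ x ∈ Icc r s, x ∈ Ioo (besselJZero k n) (besselJZero k (n + 1)) :=
    fun x hx => ⟨hr.1.trans_le hx.1, hx.2.trans_lt hs.2⟩
  have hx0 : ∀ x ∈ Icc r s, 0 < x := fun x hx => (besselJZero_pos k n).trans (hmem x hx).1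
  have hne : ∀ x ∈ Icc r s, besselJ k x ≠ 0 :=
    fun x hx => besselJ_ne_zero_of_mem_Ioo k n (hmem x hx)
  have hd : ∀ x ∈ Icc r s, DifferentiableAt ℝ (bucklingF k κ) x := fun x hx =>
    ((contDiffAt_bucklingF k (u := (κ, x)) (hx0 x hx).ne').differentiableAt one_ne_zero).comp
      (f := fun x : ℝ => (κ, x)) x (by fun_prop)
  have hsign : ∀ x ∈ Icc r s, bucklingF k κ x = 0 → 0 < besselJ k x * deriv (bucklingF k κ) x := by
    intro x hx h0
    obtain ⟨F', hF', hpos⟩ := exists_hasDerivAt_bucklingF_right k hκ (hx0 x hx) (hne x hx) h0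
    rwa [hF'.deriv]
  rcases pos_or_neg_of_ne_zero (continuous_besselJ k).continuousOn ordConnected_Icc hne with h | h
  · exact not_two_zeros_of_deriv_pos hrs hd hFr hFs
      fun x hx h0 => pos_of_mul_pos_right (hsign x hx h0) (h x hx).le
  · refine not_two_zeros_of_deriv_pos (f := fun x => -bucklingF k κ x) hrs
      (fun x hx => (hd x hx).fun_neg) (by simp [hFr]) (by simp [hFs]) fun x hx h0 => ?_
    rw [deriv.fun_neg, neg_pos]
    exact neg_of_mul_pos_right (hsign x hx (neg_eq_zero.1 h0)) (h x hx).le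

lemma bucklingF_zero_unique (k n : ℕ) {κ r s : ℝ} (hκ : 0 < κ)
    (hr : r ∈ Ioo (besselJZero k n) (besselJZero k (n + 1))) (hFr : bucklingF k κ r = 0)
    (hs : s ∈ Ioo (besselJZero k n) (besselJZero k (n + 1))) (hFs : bucklingF k κ s = 0) :
    r = s :=
  le_antisymm (not_lt.1 (bucklingF_zero_not_lt k n hκ hs hFs hr hFr))
    (not_lt.1 (bucklingF_zero_not_lt k n hκ hr hFr hs hFs))

lemma exists_mem_Ioo_of_bucklingF_eq_zero (k : ℕ) {κ x : ℝ} (hκ : 0 < κ) (hx : 0 < x)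
    (h : bucklingF k κ x = 0) : ∃ n, x ∈ Ioo (besselJZero k n) (besselJZero k (n + 1)) := by
  have hex := exists_lt_besselJZero k x
  classical
  have hlt := Nat.find_spec hex
  -- The case `0` means that `x` precedes the first zero of `J_k`, where `F_k > 0`.
  rcases hn : Nat.find hex with _ | n
  · rw [hn] at hlt
    exact absurd h (bucklingF_pos k hκ hx
      (fun y hy => besselJ_pos_of_lt_besselJZero k hy.1 (hy.2.trans hlt))
      (besselJ_pos_of_lt_besselJZero k hx hlt).le).ne'
  · rw [hn] at hlt
    refine ⟨n, (not_lt.1 (Nat.find_min hex (m := n) (by omega))).lt_of_ne ?_, hlt⟩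
    rintro rfl
    exact bucklingF_besselJZero_ne_zero k n hκ h

/-- The `n`-th root of `F_k(·, κ)` is the one between consecutive zeros of `J_k`. -/
lemma alphaRoot_succ_mem (k n : ℕ) {κ : ℝ} (hκ : 0 < κ) :
    alphaRoot k (n + 1) κ ∈ Ioo (besselJZero k n) (besselJZero k (n + 1)) ∧
      bucklingF k κ (alphaRoot k (n + 1) κ) = 0 := by
  have hmono := (strictMono_besselJZero k).monotone
  induction n with
  | zero =>
    obtain ⟨r, hr, hFr⟩ := exists_bucklingF_eq_zero k 0 hκ
    -- The starting value `alphaRoot k 0 κ = 0` makes this the set of all positive roots.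
    have hleast : IsLeast {x : ℝ | alphaRoot k 0 κ < x ∧ bucklingF k κ x = 0} r := by
      refine ⟨⟨(besselJZero_pos k 0).trans hr.1, hFr⟩, fun x hx => ?_⟩
      obtain ⟨m, hm⟩ := exists_mem_Ioo_of_bucklingF_eq_zero k hκ hx.1 hx.2
      rcases Nat.eq_zero_or_pos m with rfl | hm0
      · exact (bucklingF_zero_unique k 0 hκ hr hFr hm hx.2).le
      · exact (hr.2.trans_le ((hmono hm0).trans hm.1.le)).le
    rw [alphaRoot, hleast.csInf_eq]
    exact ⟨hr, hFr⟩
  | succ n ih =>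
    obtain ⟨r, hr, hFr⟩ := exists_bucklingF_eq_zero k (n + 1) hκ
    have hleast : IsLeast {x : ℝ | alphaRoot k (n + 1) κ < x ∧ bucklingF k κ x = 0} r := by
      refine ⟨⟨ih.1.2.trans hr.1, hFr⟩, fun x hx => ?_⟩
      have hx0 : 0 < x := ((besselJZero_pos k n).trans ih.1.1).trans hx.1
      obtain ⟨m, hm⟩ := exists_mem_Ioo_of_bucklingF_eq_zero k hκ hx0 hx.2
      rcases lt_trichotomy m (n + 1) with h | rfl | h
      · rcases (Nat.lt_succ_iff.1 h).eq_or_lt with rfl | h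
        · exact absurd (bucklingF_zero_unique k m hκ ih.1 ih.2 hm hx.2) hx.1.ne
        · exact absurd ((hm.2.trans_le (hmono h)).trans ih.1.1) hx.1.not_gt
      · exact (bucklingF_zero_unique k _ hκ hr hFr hm hx.2).le
      · exact (hr.2.trans_le ((hmono h).trans hm.1.le)).le
    rw [alphaRoot, hleast.csInf_eq]
    exact ⟨hr, hFr⟩

/-! ### Smooth dependence on `κ` and monotonicity -/

lemma contDiffAt_alphaRoot_and_deriv_neg (k n : ℕ) {κ : ℝ} (hκ : 0 < κ) :
    ContDiffAt ℝ 1 (alphaRoot k (n + 1)) κ ∧ deriv (alphaRoot k (n + 1)) κ < 0 := by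
  obtain ⟨hmem, hF⟩ := alphaRoot_succ_mem k n hκ
  have hα : 0 < alphaRoot k (n + 1) κ := (besselJZero_pos k n).trans hmem.1
  have hJ := besselJ_ne_zero_of_mem_Ioo k n hmem
  obtain ⟨fy, hy, hy0⟩ := exists_hasDerivAt_bucklingF_right k hκ hα hJ hF
  obtain ⟨fx, hx, hx0⟩ := exists_hasDerivAt_bucklingF_left k hκ hα hJ hF
  have hfy : fy ≠ 0 := by rintro rfl; simp at hy0
  obtain ⟨φ, hφ, hφκ, hev, hderiv⟩ := exists_implicit_function
    (contDiffAt_bucklingF k (u := (κ, alphaRoot k (n + 1) κ)) hα.ne') hx hy hfy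
  -- By continuity the implicit branch stays in the same gap, where uniqueness identifies it with
  -- `alphaRoot`.
  have heq : alphaRoot k (n + 1) =ᶠ[𝓝 κ] φ := by
    have hφmem := hφ.continuousAt.eventually_mem (Ioo_mem_nhds (hφκ.symm ▸ hmem.1)
      (hφκ.symm ▸ hmem.2))
    filter_upwards [hev, hφmem, lt_mem_nhds hκ] with x hx1 hx2 hx3
    obtain ⟨hm, h0⟩ := alphaRoot_succ_mem k n hx3
    exact bucklingF_zero_unique k n hx3 hm h0 hx2 (hx1.trans hF)
  refine ⟨hφ.congr_of_eventuallyEq heq, ?_⟩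
  -- Multiplying numerator and denominator by `J_k(α)` makes both positive, whatever its sign.
  rw [heq.deriv_eq, hderiv, neg_div, neg_lt_zero, ← mul_div_mul_left _ _ hJ]
  exact div_pos hx0 hy0

theorem lemma3p5 (k : ℕ) :
    (∀ κ : ℝ, 0 < κ →
      StrictMono (fun n : ℕ => alphaRoot k (n + 1) κ) ∧
      Set.range (fun n : ℕ => alphaRoot k (n + 1) κ) = {x : ℝ | 0 < x ∧ bucklingF k κ x = 0}) ∧
    ∀ ℓ : ℕ, 1 ≤ ℓ →
      ContDiffOn ℝ 1 (alphaRoot k ℓ) (Set.Ioi 0) ∧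
      ∀ κ : ℝ, 0 < κ → deriv (alphaRoot k ℓ) κ < 0 := by
  refine ⟨fun κ hκ => ⟨strictMono_nat_of_lt_succ fun n => ?_, ?_⟩, fun ℓ hℓ => ?_⟩
  · exact (alphaRoot_succ_mem k n hκ).1.2.trans (alphaRoot_succ_mem k (n + 1) hκ).1.1
  · refine Set.Subset.antisymm ?_ fun x hx => ?_
    · rintro _ ⟨n, rfl⟩
      obtain ⟨h, h0⟩ := alphaRoot_succ_mem k n hκ
      exact ⟨(besselJZero_pos k n).trans h.1, h0⟩
    · obtain ⟨n, hn⟩ := exists_mem_Ioo_of_bucklingF_eq_zero k hκ hx.1 hx.2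
      obtain ⟨h, h0⟩ := alphaRoot_succ_mem k n hκ
      exact ⟨n, bucklingF_zero_unique k n hκ h h0 hn hx.2⟩
  · obtain ⟨n, rfl⟩ := Nat.exists_eq_add_of_le' hℓ
    exact ⟨fun κ hκ => (contDiffAt_alphaRoot_and_deriv_neg k n hκ).1.contDiffWithinAt,
      fun κ hκ => (contDiffAt_alphaRoot_and_deriv_neg k n hκ).2⟩
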